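/- **Definitions.** Let $B_4=\langle \sigma_1,\sigma_2,\sigma_3\mid \sigma_1\sigma_2\sigma_1=\sigma_2\sigma_1\sigma_2,\ \sigma_2\sigma_3\sigma_2=\sigma_3\sigma_2\sigma_3,\ \sigma_1\sigma_3=\sigma_3\sigma_1\rangle$ be the braid group on four strings (modulo its centre it is a subgroup of index two in $\mathrm{Aut}(F_2)$), let $\delta=\sigma_1\sigma_2\sigma_3$, and let $a_{ij}=(\sigma_i\cdots\sigma_{j-2})\,\sigma_{j-1}\,(\sigma_i\cdots\sigma_{j-2})^{-1}$, $1\le i<j\le 4$, be its six band generators. The *Brady complex* $X$ is the following 2-complex. As a simplicial complex, its vertices are the cosets $g\langle\delta\rangle$, $g\in B_4$, and its 2-simplices are the sets $\{g\langle\delta\rangle,\ gx\langle\delta\rangle,\ gxy\langle\delta\rangle\}$, where $g\in B_4$ and $x,y,z$ are band generators with $xyz=\delta$. Each simplicial edge is a side of either two or three 2-simplices. Those that are sides of three are the edges of $X$; those that are sides of two are called short diagonals. The faces of $X$ are the *triangles*, that is, the 2-simplices whose three sides are edges of $X$, and the *lozenges*, that is, the unions of two distinct 2-simplices along a common short diagonal.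 An *enveloping surface* in $X$ is a connected surface without boundary, made of faces of $X$ glued along edges of $X$, which visits every edge of $X$ precisely once; that is, a nonempty set of faces such that every edge of $X$ lies on the boundary of precisely two faces of the set, and any two faces of the set are joined by a chain of faces of the set in which consecutive ones share an edge. A *Hamiltonian surface* in $X$ is an enveloping surface without multiple vertices, that is, one that passes through every vertex of $X$ precisely once: its link at every vertex of $X$ is a single cycle, passing through all the edges of $X$ at that vertex. **Theorem.** Every lozenge of the Brady complex $X$ is contained in exactly one Hamiltonian surface in $X$. -/

import Mathlib

namespace Brady

/-- Artin's relators for the braid group on four strings. -/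
def artinRels : Set (FreeGroup (Fin 3)) :=
  {FreeGroup.of 0 * FreeGroup.of 1 * FreeGroup.of 0 *
      (FreeGroup.of 1 * FreeGroup.of 0 * FreeGroup.of 1)⁻¹,
    FreeGroup.of 1 * FreeGroup.of 2 * FreeGroup.of 1 *
      (FreeGroup.of 2 * FreeGroup.of 1 * FreeGroup.of 2)⁻¹,
    FreeGroup.of 0 * FreeGroup.of 2 * (FreeGroup.of 2 * FreeGroup.of 0)⁻¹}

/-- The braid group `B₄` on four strings. Modulo its centre it is a subgroup of index two
in `Aut(F₂)`. -/
abbrev B4 : Type := PresentedGroup artinRels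

/-- The standard generators `σ₁, σ₂, σ₃` of `B₄` (indexed from `0`). -/
def σ (i : Fin 3) : B4 := PresentedGroup.of i

/-- The dual Garside element `δ = σ₁σ₂σ₃`; its power `δ⁴` generates the centre of `B₄`. -/
def δ : B4 := σ 0 * σ 1 * σ 2

/-- The six band generators
`a_{ij} = (σ_i ⋯ σ_{j-2}) σ_{j-1} (σ_i ⋯ σ_{j-2})⁻¹`, `1 ≤ i < j ≤ 4`, of `B₄`
(in the order `a₁₂, a₂₃, a₃₄, a₁₃, a₂₄, a₁₄`). -/
def bandGenerators : Set B4 :=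
  {σ 0, σ 1, σ 2,
    σ 0 * σ 1 * (σ 0)⁻¹,
    σ 1 * σ 2 * (σ 1)⁻¹,
    σ 0 * σ 1 * σ 2 * (σ 0 * σ 1)⁻¹}

/-- The vertices of the Brady complex `X`: the left cosets `g⟨δ⟩` in `B₄`. -/
abbrev Vertex : Type := B4 ⧸ Subgroup.zpowers δ

/-- The vertex `g⟨δ⟩`. -/
def vtx (g : B4) : Vertex := QuotientGroup.mk g

/-- The 2-simplices (given by their vertex sets) of the Brady complex, seen as a simplicial
complex: the sets `{g⟨δ⟩, gx⟨δ⟩, gxy⟨δ⟩}`, where `g ∈ B₄` and `x, y, z` are band generators with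
`xyz = δ`. -/
def simplices : Set (Set Vertex) :=
  {T | ∃ g : B4, ∃ x ∈ bandGenerators, ∃ y ∈ bandGenerators, ∃ z ∈ bandGenerators,
    x * y * z = δ ∧ T = {vtx g, vtx (g * x), vtx (g * x * y)}}

/-- The sides of a 2-simplex: the unordered pairs of distinct vertices of it. -/
def sides (T : Set Vertex) : Set (Sym2 Vertex) :=
  {e | ¬ e.IsDiag ∧ ∀ v ∈ e, v ∈ T}

/-- The order of a simplicial edge: the number of 2-simplices that it is a side of. -/
noncomputable def order (e : Sym2 Vertex) : ℕ∞ :=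
  {T | T ∈ simplices ∧ e ∈ sides T}.encard

/-- The edges of the Brady complex, as a complex of triangles and lozenges: the simplicial edges
of order three. (The other simplicial edges have order two; they are the short diagonals of the
lozenges.) -/
def edges : Set (Sym2 Vertex) := {e | order e = 3}

/-- The triangles of `X`: the 2-simplices all of whose sides are edges of order three.
A 2-cell of `X` is given by the set of edges in its boundary. -/
def IsTriangle (f : Set (Sym2 Vertex)) : Prop :=
  ∃ T ∈ simplices, sides T ⊆ edges ∧ f = sides T

/-- The lozenges of `X`: the unions of two distinct 2-simplices along a common side of order two
(the short diagonal). The boundary consists of the four remaining sides. -/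
def IsLozenge (f : Set (Sym2 Vertex)) : Prop :=
  ∃ T ∈ simplices, ∃ T' ∈ simplices, ∃ d : Sym2 Vertex,
    T ≠ T' ∧ d ∈ sides T ∧ d ∈ sides T' ∧ order d = 2 ∧ f = (sides T ∪ sides T') \ {d}

/-- The 2-cells of the Brady complex, each given by its set of boundary edges. -/
def faces : Set (Set (Sym2 Vertex)) := {f | IsTriangle f ∨ IsLozenge f}

/-- The link at the vertex `v` of the union of a set `S` of faces: its vertices are the edges of
`X` at `v`, and two of them are joined when they bound a corner at `v` of a face in `S`. -/
def link (S : Set (Set (Sym2 Vertex))) (v : Vertex) :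
    SimpleGraph {e : Sym2 Vertex // e ∈ edges ∧ v ∈ e} where
  Adj e e' := e ≠ e' ∧ ∃ f ∈ S, e.1 ∈ f ∧ e'.1 ∈ f
  symm := ⟨fun _ _ h => ⟨h.1.symm, h.2.imp fun _ hf => ⟨hf.1, hf.2.2, hf.2.1⟩⟩⟩
  loopless := ⟨fun _ h => h.1 rfl⟩

/-- Enveloping surfaces in `X`, given by their faces: connected surfaces without boundary that
visit every edge of `X` precisely once. That is, along every edge of `X` precisely two faces of `S`
meet, and any two faces of `S` are joined by a chain of faces of `S` in which consecutive ones share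
an edge. Gluing the faces of `S` along the edges of `X` gives a connected surface without boundary:
every vertex of `X` lies on finitely many edges, so the link of `S` there, in which every vertex has
degree two, is a disjoint union of circles. There may be several of these circles, and then the
surface has a multiple vertex there. -/
structure IsEnvelopingSurface (S : Set (Set (Sym2 Vertex))) : Prop where
  subset_faces : S ⊆ faces
  nonempty : S.Nonempty
  two_faces : ∀ e ∈ edges, {f | f ∈ S ∧ e ∈ f}.encard = 2
  connected : ∀ f ∈ S, ∀ f' ∈ S,
    Relation.ReflTransGen (fun a b => a ∈ S ∧ b ∈ S ∧ (a ∩ b).Nonempty) f f'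

/-- Hamiltonian surfaces in `X`: enveloping surfaces without multiple vertices. That is, the
surface passes through every vertex of `X` precisely once: its link there is a single circle. -/
structure IsHamiltonianSurface (S : Set (Set (Sym2 Vertex))) : Prop
    extends IsEnvelopingSurface S where
  link_connected : ∀ v : Vertex, (link S v).Connected

end Brady

namespace Brady

/-! Everything is labelled by braids. Up to right multiplication by the central element `δ ^ 4`, a
braid `k` is the same as an oriented edge from `k⟨δ⟩` to `kσ₁⟨δ⟩`. Triangles are orbits of `k ↦ k *
u` (where `u ^ 3 = δ ^ 4`), and lozenges are orbits of `k ↦ k * δ ^ 2`. Exactly three faces contain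
the edge `k`: its triangle, `lozenge k` and `lozenge (k * q⁻¹)`. So a surface omits precisely one of
these three at every edge. Exponent sums and permutations tell the labels apart.

At a vertex `g`, the link of all faces has eight vertices: four outgoing edges `gδⁿ` and four
incoming edges `gδⁿσ₁⁻¹`. It is a Möbius ladder: triangle corners and acute lozenge corners
alternate around an 8-cycle, and obtuse lozenge corners are the four chords joining antipodal
points. The omitted corners form a perfect matching, and connectedness of the link excludes omitting
all triangle corners or all acute corners. In the remaining matchings, either all four chords are
omitted, or two neighbouring chords and two antipodal rim edges are (`matching_of_link`).

Comparing the vertices of a triangle, this local rule makes membership of `lozenge k` invariant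
under `k ↦ k * u` (`lozenge_mul_u_mem_iff`). Then no triangle can be omitted (`triangle_mem`), and
membership of `lozenge k` flips under `k ↦ k * δ` and `k ↦ k * σ 0`. As `σ 0` and `δ` generate the
group, it depends only on the parity of the exponent sum: one lozenge determines the surface.
Conversely, all triangles together with the lozenges of one parity do form a Hamiltonian surface
(`paritySurface_isHamiltonian`). -/

/-! ### Conjugation by `δ` in the braid group. -/

theorem braid_zero_one : σ 0 * σ 1 * σ 0 = σ 1 * σ 0 * σ 1 :=
  PresentedGroup.mk_eq_mk_of_mul_inv_mem (rels := artinRels) (by simp [artinRels])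

theorem braid_one_two : σ 1 * σ 2 * σ 1 = σ 2 * σ 1 * σ 2 :=
  PresentedGroup.mk_eq_mk_of_mul_inv_mem (rels := artinRels) (by simp [artinRels])

theorem commute_zero_two : σ 0 * σ 2 = σ 2 * σ 0 :=
  PresentedGroup.mk_eq_mk_of_mul_inv_mem (rels := artinRels) (by simp [artinRels])

theorem δ_mul_σ_zero : δ * σ 0 = σ 1 * δ := by
  simp only [δ]
  calc σ 0 * σ 1 * σ 2 * σ 0 = σ 0 * σ 1 * (σ 2 * σ 0) := by group
    _ = (σ 0 * σ 1 * σ 0) * σ 2 := by rw [← commute_zero_two]; group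
    _ = _ := by rw [braid_zero_one]; group

theorem δ_mul_σ_one : δ * σ 1 = σ 2 * δ := by
  simp only [δ]
  calc σ 0 * σ 1 * σ 2 * σ 1 = σ 0 * (σ 1 * σ 2 * σ 1) := by group
    _ = (σ 0 * σ 2) * σ 1 * σ 2 := by rw [braid_one_two]; group
    _ = _ := by rw [commute_zero_two]; group

theorem δ_sq_mul_σ_two : δ ^ 2 * σ 2 = σ 0 * δ ^ 2 := by
  have h : δ ^ 2 = σ 1 * σ 2 * δ * σ 2 := by
    calc δ ^ 2 = (δ * σ 0) * σ 1 * σ 2 := by rw [pow_two]; nth_rw 2 [δ]; group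
      _ = σ 1 * (δ * σ 1) * σ 2 := by rw [δ_mul_σ_zero]; group
      _ = _ := by rw [δ_mul_σ_one]; group
  calc δ ^ 2 * σ 2 = (σ 0 * σ 1 * σ 2) * δ * σ 2 := by rw [pow_two]; rfl
    _ = σ 0 * δ ^ 2 := by rw [h]; group

/-- Conjugation by `δ`, a rotation of the four strings. -/
def rot (x : B4) : B4 := δ * x * δ⁻¹

theorem rot_σ_zero : rot (σ 0) = σ 1 := by rw [rot, δ_mul_σ_zero]; group
theorem rot_σ_one : rot (σ 1) = σ 2 := by rw [rot, δ_mul_σ_one]; group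
theorem rot_mul (x y : B4) : rot (x * y) = rot x * rot y := by simp only [rot]; group
theorem rot_inv (x : B4) : rot x⁻¹ = (rot x)⁻¹ := by simp only [rot]; group
theorem δ_mul (x : B4) : δ * x = rot x * δ := by simp only [rot]; group

theorem rot_rot_σ_two : rot (rot (σ 2)) = σ 0 := by
  have : rot (rot (σ 2)) = δ ^ 2 * σ 2 * (δ ^ 2)⁻¹ := by simp only [rot, pow_two]; group
  rw [this, δ_sq_mul_σ_two]; group

/-- The band generator `a₁₃`. -/
def diagGen : B4 := σ 0 * σ 1 * (σ 0)⁻¹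

theorem rot_diagGen : rot diagGen = σ 1 * σ 2 * (σ 1)⁻¹ := by
  simp only [diagGen, rot_mul, rot_inv, rot_σ_zero, rot_σ_one]

theorem rot_σ_two : rot (σ 2) = σ 0 * σ 1 * σ 2 * (σ 0 * σ 1)⁻¹ := by
  simp only [rot, δ]; group

theorem rot_rot_diagGen : rot (rot diagGen) = diagGen := by
  simp only [diagGen, rot_mul, rot_inv, rot_σ_zero, rot_σ_one]
  rw [rot_σ_two]
  calc σ 2 * (σ 0 * σ 1 * σ 2 * (σ 0 * σ 1)⁻¹) * (σ 2)⁻¹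
      = (σ 2 * σ 0) * σ 1 * σ 2 * (σ 1)⁻¹ * (σ 2 * σ 0)⁻¹ := by group
    _ = σ 0 * (σ 2 * σ 1 * σ 2) * (σ 1)⁻¹ * (σ 2)⁻¹ * (σ 0)⁻¹ := by rw [← commute_zero_two]; group
    _ = _ := by rw [← braid_one_two]; group

theorem commute_δ_sq_diagGen : δ ^ 2 * diagGen = diagGen * δ ^ 2 := by
  have := rot_rot_diagGen
  simp only [rot] at this
  have h : δ ^ 2 * diagGen = (δ * (δ * diagGen * δ⁻¹) * δ⁻¹) * δ ^ 2 := by simp only [pow_two]; group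
  rw [h, this]

theorem commute_δ_pow_four : δ ^ 4 * σ 0 = σ 0 * δ ^ 4 := by
  have h : δ ^ 4 * σ 0 = δ ^ 2 * σ 2 * δ ^ 2 := by
    have : δ ^ 4 * σ 0 = δ ^ 2 * rot (rot (σ 0)) * δ ^ 2 := by simp only [rot]; group
    rw [this, rot_σ_zero, rot_σ_one]
  rw [h, δ_sq_mul_σ_two]; group

theorem diagGen_mul : diagGen * σ 0 * σ 2 = δ := by simp only [diagGen, δ]; group

/-! ### Invariants of braids: exponent sum and permutation. -/

/-- The abelianization of `B₄`, sending each generator to `1`. -/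
def lenHom : B4 →* Multiplicative ℤ :=
  PresentedGroup.toGroup (f := fun _ => Multiplicative.ofAdd 1) (by
    rintro r (rfl | rfl | rfl) <;> simp)

/-- The exponent sum of an element of `B₄`. -/
def len (g : B4) : ℤ := (lenHom g).toAdd

theorem len_mul (g h : B4) : len (g * h) = len g + len h := by simp [len]
theorem len_inv (g : B4) : len g⁻¹ = - len g := by simp [len]
theorem len_zpow (g : B4) (n : ℤ) : len (g ^ n) = n * len g := by simp [len]
theorem len_pow (g : B4) (n : ℕ) : len (g ^ n) = n * len g := by simp [len]
theorem len_σ (i : Fin 3) : len (σ i) = 1 := by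
  simp [len, lenHom, σ, PresentedGroup.toGroup.of]
theorem len_δ : len δ = 3 := by simp [δ, len_mul, len_σ]
theorem len_diagGen : len diagGen = 1 := by simp [diagGen, len_mul, len_inv, len_σ]

/-- The permutation of the strings induced by a braid. -/
def perm : B4 →* Equiv.Perm (Fin 4) :=
  PresentedGroup.toGroup (f := ![Equiv.swap 0 1, Equiv.swap 1 2, Equiv.swap 2 3]) (by
    rintro r (rfl | rfl | rfl) <;> simp <;> decide)

theorem perm_σ (i : Fin 3) :
    perm (σ i) = ![Equiv.swap 0 1, Equiv.swap 1 2, Equiv.swap 2 3] i := by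
  simp [perm, σ, PresentedGroup.toGroup.of]

/-- A property of braids that is invariant under right multiplication by `σ₁` and `δ` is
constant. -/
theorem iff_of_invariant {P : B4 → Prop} (hσ : ∀ k, P (k * σ 0) ↔ P k)
    (hδ : ∀ k, P (k * δ) ↔ P k) (g h : B4) : P g ↔ P h := by
  let H : Subgroup B4 :=
    { carrier := {x | ∀ k, P (k * x) ↔ P k}
      mul_mem' := fun {a b} ha hb k => by rw [← mul_assoc]; exact (hb _).trans (ha _)
      one_mem' := fun k => by rw [mul_one]
      inv_mem' := fun {a} ha k => by
        have := ha (k * a⁻¹); rw [inv_mul_cancel_right] at this; exact this.symm }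
  have h0 : σ 0 ∈ H := hσ
  have hd : δ ∈ H := hδ
  have hr : ∀ x ∈ H, rot x ∈ H := fun x hx => H.mul_mem (H.mul_mem hd hx) (H.inv_mem hd)
  have h1 : σ 1 ∈ H := rot_σ_zero ▸ hr _ h0
  have h2 : σ 2 ∈ H := rot_σ_one ▸ hr _ h1
  have htop : H = ⊤ := by
    rw [eq_top_iff, ← PresentedGroup.closure_range_of artinRels, Subgroup.closure_le]
    rintro _ ⟨i, rfl⟩
    fin_cases i
    exacts [h0, h1, h2]
  have : g⁻¹ * h ∈ H := htop ▸ Subgroup.mem_top _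
  simpa using (this g).symm

theorem vtx_eq_iff {g h : B4} : vtx g = vtx h ↔ ∃ n : ℤ, h = g * δ ^ n := by
  rw [vtx, vtx, QuotientGroup.eq, Subgroup.mem_zpowers_iff]
  exact exists_congr fun n => by rw [eq_inv_mul_iff_mul_eq, eq_comm]

theorem vtx_mul_zpow (g : B4) (n : ℤ) : vtx (g * δ ^ n) = vtx g :=
  (vtx_eq_iff.2 ⟨n, rfl⟩).symm

theorem vtx_mul_pow (g : B4) (n : ℕ) : vtx (g * δ ^ n) = vtx g := by
  simpa using vtx_mul_zpow g n

theorem vtx_mul_δ (g : B4) : vtx (g * δ) = vtx g := by simpa using vtx_mul_zpow g 1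

theorem vtx_ne {g h : B4} (hl : ¬ (3 : ℤ) ∣ len h - len g) : vtx g ≠ vtx h := by
  intro e
  obtain ⟨n, rfl⟩ := vtx_eq_iff.1 e
  exact hl ⟨n, by rw [len_mul, len_zpow, len_δ]; ring⟩

theorem perm_δ_zpow (n : ℤ) : ∃ r : Fin 4, (r : ℤ) = n % 4 ∧ perm (δ ^ n) = perm δ ^ (r : ℕ) := by
  have h4 : perm δ ^ 4 = 1 := by simp only [δ, map_mul, perm_σ]; decide
  have hr : 0 ≤ n % 4 := by omega
  refine ⟨⟨(n % 4).toNat, by omega⟩, by simp [hr], ?_⟩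
  have : n = 4 * (n / 4) + ((n % 4).toNat : ℤ) := by rw [Int.toNat_of_nonneg hr]; omega
  rw [map_zpow]
  conv_lhs => rw [this]
  rw [zpow_add, zpow_mul, zpow_natCast]
  have : (perm δ ^ (4 : ℤ)) = 1 := by exact_mod_cast h4
  rw [this, one_zpow, one_mul]

/-- The permutation of `δ` is a 4-cycle rotating a square. A side of the square is fixed only by the
trivial rotation, a diagonal also by the half turn; hence 4 here and 2 for `diagGen`. -/
theorem four_dvd_of_commute {n : ℤ} (h : δ ^ n * σ 0 = σ 0 * δ ^ n) : (4 : ℤ) ∣ n := by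
  obtain ⟨r, hr, e⟩ := perm_δ_zpow n
  have h' := congrArg perm h
  rw [map_mul, map_mul, e] at h'
  simp only [δ, map_mul, perm_σ] at h'
  have : r = 0 := by clear hr e h; revert r; decide
  subst this
  simp at hr
  omega

theorem two_dvd_of_commute {n : ℤ} (h : δ ^ n * diagGen = diagGen * δ ^ n) : (2 : ℤ) ∣ n := by
  obtain ⟨r, hr, e⟩ := perm_δ_zpow n
  have h' := congrArg perm h
  rw [map_mul, map_mul, e] at h'
  simp only [δ, diagGen, map_mul, map_inv, perm_σ] at h'
  have : r = 0 ∨ r = 2 := by clear hr e h; revert r; decide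
  rcases this with rfl | rfl <;> simp at hr <;> omega

theorem not_conj_diagGen {n : ℤ} (h : δ ^ n * σ 0 = diagGen * δ ^ n) : False := by
  obtain ⟨r, hr, e⟩ := perm_δ_zpow n
  have h' := congrArg perm h
  rw [map_mul, map_mul, e] at h'
  simp only [δ, diagGen, map_mul, map_inv, perm_σ] at h'
  clear hr e h; revert r; decide

/-! ### Labelling edges and short diagonals by braids. -/

/-- The edge of `X` from `k⟨δ⟩` to `kσ₁⟨δ⟩`. -/
def edge (k : B4) : Sym2 Vertex := s(vtx k, vtx (k * σ 0))

/-- The short diagonal from `ka₁₃⁻¹⟨δ⟩` to `k⟨δ⟩`. -/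
def diag (k : B4) : Sym2 Vertex := s(vtx (k * diagGen⁻¹), vtx k)

/-- The rotation of a triangle of `X`. -/
def u : B4 := σ 0 * δ

/-- An element taking an edge to a consecutive edge of a lozenge. -/
def q : B4 := σ 0 * δ ^ 2

theorem len_u : len u = 4 := by simp [u, len_mul, len_σ, len_δ]
theorem len_q : len q = 7 := by simp [q, len_mul, len_pow, len_σ, len_δ]

theorem vtx_eq_or_of_mem_edge {k : B4} {v : Vertex} :
    v ∈ edge k ↔ v = vtx k ∨ v = vtx (k * σ 0) := by simp [edge]

theorem commute_δ_pow_four_zpow (m : ℤ) : δ ^ (4 * m) * σ 0 = σ 0 * δ ^ (4 * m) := by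
  have h : Commute (δ ^ (4 : ℤ)) (σ 0) := by exact_mod_cast commute_δ_pow_four
  rw [zpow_mul]
  exact (h.zpow_left m).eq

/-- Exponent sums modulo 3 are well defined on vertices and increase by 1 along an edge, so an edge
cannot be matched with a reversed one. With orientations agreeing, the two powers of `δ` coincide
and commute with `σ 0`. -/
theorem edge_eq_iff {k h : B4} : edge k = edge h ↔ ∃ m : ℤ, h = k * δ ^ (4 * m) := by
  constructor
  · intro e
    rcases Sym2.eq_iff.1 e with ⟨h1, h2⟩ | ⟨h1, h2⟩
    · obtain ⟨n, rfl⟩ := vtx_eq_iff.1 h1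
      obtain ⟨m, hm⟩ := vtx_eq_iff.1 h2
      have hl := congrArg len hm
      simp only [len_mul, len_zpow, len_σ, len_δ] at hl
      obtain rfl : n = m := by omega
      rw [mul_assoc, mul_assoc, mul_right_inj] at hm
      obtain ⟨a, rfl⟩ := four_dvd_of_commute hm
      exact ⟨a, rfl⟩
    · exfalso
      obtain ⟨n, hn⟩ := vtx_eq_iff.1 h1
      obtain ⟨m, hm⟩ := vtx_eq_iff.1 h2
      have hl := congrArg len hm
      have hl' := congrArg len hn
      simp only [len_mul, len_zpow, len_σ, len_δ] at hl hl'
      omega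
  · rintro ⟨m, rfl⟩
    rw [edge, edge, mul_assoc k, commute_δ_pow_four_zpow, ← mul_assoc, vtx_mul_zpow, vtx_mul_zpow]

theorem edge_mul_zpow (k : B4) (m : ℤ) : edge (k * δ ^ (4 * m)) = edge k :=
  (edge_eq_iff.2 ⟨m, rfl⟩).symm

theorem edge_mul_pow_four (k : B4) : edge (k * δ ^ 4) = edge k := by
  simpa using edge_mul_zpow k 1

theorem edge_ne {k h : B4} (hl : ¬ (12 : ℤ) ∣ len h - len k) : edge k ≠ edge h := by
  intro e
  obtain ⟨m, rfl⟩ := edge_eq_iff.1 e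
  exact hl ⟨m, by rw [len_mul, len_zpow, len_δ]; ring⟩

theorem commute_δ_sq_zpow (m : ℤ) : δ ^ (2 * m) * diagGen = diagGen * δ ^ (2 * m) := by
  have h : Commute (δ ^ (2 : ℤ)) diagGen := by exact_mod_cast commute_δ_sq_diagGen
  rw [zpow_mul]
  exact (h.zpow_left m).eq

theorem diag_eq_iff {k h : B4} : diag k = diag h ↔ ∃ m : ℤ, h = k * δ ^ (2 * m) := by
  constructor
  · intro e
    rcases Sym2.eq_iff.1 e with ⟨h1, h2⟩ | ⟨h1, h2⟩
    · obtain ⟨n, rfl⟩ := vtx_eq_iff.1 h2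
      obtain ⟨m, hm⟩ := vtx_eq_iff.1 h1
      have hl := congrArg len hm
      simp only [len_mul, len_zpow, len_inv, len_diagGen, len_δ] at hl
      obtain rfl : n = m := by omega
      rw [mul_assoc, mul_assoc, mul_right_inj] at hm
      obtain ⟨a, rfl⟩ := two_dvd_of_commute (n := n) (by
        rw [mul_inv_eq_iff_eq_mul, mul_assoc, eq_inv_mul_iff_mul_eq] at hm
        exact hm.symm)
      exact ⟨a, rfl⟩
    · exfalso
      obtain ⟨n, hn⟩ := vtx_eq_iff.1 h1
      obtain ⟨m, hm⟩ := vtx_eq_iff.1 h2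
      have hl := congrArg len hm
      have hl' := congrArg len hn
      simp only [len_mul, len_zpow, len_inv, len_diagGen, len_δ] at hl hl'
      omega
  · rintro ⟨m, rfl⟩
    have : δ ^ (2 * m) * diagGen⁻¹ = diagGen⁻¹ * δ ^ (2 * m) := by
      rw [mul_inv_eq_iff_eq_mul, mul_assoc, eq_inv_mul_iff_mul_eq, commute_δ_sq_zpow]
    rw [diag, diag, mul_assoc k, this, ← mul_assoc, vtx_mul_zpow, vtx_mul_zpow]

theorem diag_mul_sq (k : B4) : diag (k * δ ^ 2) = diag k :=
  (diag_eq_iff.2 ⟨1, by simp⟩).symm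

theorem edge_ne_diag (k h : B4) : edge k ≠ diag h := by
  intro e
  rcases Sym2.eq_iff.1 e with ⟨h1, h2⟩ | ⟨h1, h2⟩
  · obtain ⟨n, hn⟩ := vtx_eq_iff.1 h1.symm
    subst hn
    obtain ⟨m, hm⟩ := vtx_eq_iff.1 h2.symm
    have hl := congrArg len hm
    simp only [len_mul, len_zpow, len_inv, len_diagGen, len_δ, len_σ] at hl
    obtain rfl : n = m := by omega
    rw [mul_assoc, mul_assoc, mul_right_inj, inv_mul_eq_iff_eq_mul] at hm
    exact not_conj_diagGen hm
  · obtain ⟨n, hn⟩ := vtx_eq_iff.1 h1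
    obtain ⟨m, hm⟩ := vtx_eq_iff.1 h2
    have hl := congrArg len hm
    have hl' := congrArg len hn
    simp only [len_mul, len_zpow, len_inv, len_diagGen, len_δ, len_σ] at hl hl'
    omega

/-! ### Classification of the 2-simplices and their sides. -/

/-- The 2-simplices with three sides of order three. -/
def triSimplex (k : B4) : Set Vertex := {vtx k, vtx (k * σ 0), vtx (k * σ 0 * σ 1)}

/-- The 2-simplices having a short diagonal as a side. -/
def halfSimplex (k : B4) : Set Vertex := {vtx (k * diagGen⁻¹), vtx k, vtx (k * σ 0)}

theorem rot_pow_four : rot (rot (rot (rot (σ 0)))) = σ 0 := by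
  rw [rot_σ_zero, rot_σ_one, rot_rot_σ_two]

/-- The band generators, as the orbits of `a₁₂` and `a₁₃` under rotation. -/
def band : Fin 6 → B4 :=
  ![σ 0, rot (σ 0), rot (rot (σ 0)), rot (rot (rot (σ 0))), diagGen, rot diagGen]

theorem mem_bandGenerators_iff {x : B4} : x ∈ bandGenerators ↔ ∃ i, band i = x := by
  simp only [bandGenerators, ← rot_σ_two, ← rot_diagGen, Set.mem_insert_iff,
    Set.mem_singleton_iff, Fin.exists_fin_succ, band]
  simp [rot_σ_zero, rot_σ_one, diagGen, eq_comm]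
  tauto

/-- The words in the first two letters of the factorizations of `δ` into band generators. -/
def bandPairs : List (Fin 6 × Fin 6) :=
  [(0, 1), (1, 2), (2, 3), (3, 0), (4, 0), (5, 1), (4, 2), (5, 3),
    (0, 2), (1, 3), (2, 0), (3, 1), (0, 5), (1, 4), (2, 5), (3, 4)]

/-- The images in the symmetric group already leave only sixteen candidates for the first two
factors, so a finite check suffices. -/
theorem mem_bandPairs {i j k : Fin 6} (h : band i * band j * band k = δ) :
    (i, j) ∈ bandPairs := by
  have hp : ∀ i, perm (band i) = ![Equiv.swap 0 1, Equiv.swap 1 2, Equiv.swap 2 3,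
      Equiv.swap 0 3, Equiv.swap 0 2, Equiv.swap 1 3] i := by
    intro i
    fin_cases i <;> simp [band, rot_σ_zero, rot_σ_one, rot_σ_two, diagGen, perm_σ] <;>
      decide
  have h' := congrArg perm h
  simp only [δ, map_mul, hp, perm_σ] at h'
  clear h hp
  revert i j k
  decide

/-- The pair `(x, y)` only spans simplices of one of the two kinds. -/
def SpansSimplex (x y : B4) : Prop :=
  ∀ g, ∃ k, ({vtx g, vtx (g * x), vtx (g * x * y)} : Set Vertex) = triSimplex k ∨
    ({vtx g, vtx (g * x), vtx (g * x * y)} : Set Vertex) = halfSimplex k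

theorem SpansSimplex.rot {x y : B4} (h : SpansSimplex x y) : SpansSimplex (rot x) (rot y) := by
  intro g
  obtain ⟨k, hk⟩ := h (g * δ)
  refine ⟨k, ?_⟩
  have h1 : vtx (g * Brady.rot x) = vtx (g * δ * x) := by
    rw [← vtx_mul_δ, mul_assoc, ← δ_mul, mul_assoc]
  have h2 : vtx (g * Brady.rot x * Brady.rot y) = vtx (g * δ * x * y) := by
    rw [← vtx_mul_δ, mul_assoc, ← δ_mul, mul_assoc g, ← mul_assoc _ δ, ← δ_mul]
    simp only [mul_assoc]
  rwa [h1, h2, ← vtx_mul_δ g]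

theorem spansSimplex_tri : SpansSimplex (σ 0) (rot (σ 0)) := by
  intro g
  rw [rot_σ_zero]
  exact ⟨g, Or.inl rfl⟩

theorem spansSimplex_half₁ : SpansSimplex diagGen (σ 0) :=
  fun g => ⟨g * diagGen, Or.inr (by rw [halfSimplex, mul_inv_cancel_right])⟩

theorem spansSimplex_half₂ : SpansSimplex (σ 0) (rot (rot (σ 0))) := by
  refine fun g => ⟨g, Or.inr ?_⟩
  have : vtx (g * σ 0 * σ 2) = vtx (g * diagGen⁻¹) := by
    rw [← vtx_mul_δ (g * diagGen⁻¹), ← diagGen_mul]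
    congr 1; group
  rw [rot_σ_zero, rot_σ_one, this, halfSimplex]
  ext v; simp only [Set.mem_insert_iff, Set.mem_singleton_iff]; tauto

theorem spansSimplex_half₃ : SpansSimplex (σ 0) (rot diagGen) := by
  refine fun g => ⟨g * σ 0 * rot diagGen * δ, Or.inr ?_⟩
  have h1 : vtx (g * σ 0 * rot diagGen * δ * diagGen⁻¹) = vtx (g * σ 0) := by
    rw [mul_assoc _ _ δ, ← δ_mul, ← mul_assoc, mul_inv_cancel_right, vtx_mul_δ]
  have h2 : vtx (g * σ 0 * rot diagGen * δ * σ 0) = vtx g := by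
    rw [mul_assoc _ _ δ, ← δ_mul, ← vtx_mul_pow g 2]
    congr 1
    calc g * σ 0 * (δ * diagGen) * σ 0 = g * σ 0 * (δ * σ 0) * σ 1 := by
          rw [diagGen]; group
      _ = g * σ 0 * σ 1 * (δ * σ 1) := by rw [δ_mul_σ_zero]; group
      _ = g * (σ 0 * σ 1 * σ 2) * δ := by rw [δ_mul_σ_one]; group
      _ = g * δ ^ 2 := by rw [pow_two, mul_assoc g]; rfl
  rw [halfSimplex, h1, h2, vtx_mul_δ]
  ext v; simp only [Set.mem_insert_iff, Set.mem_singleton_iff]; tauto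

theorem triSimplex_mem (k : B4) : triSimplex k ∈ simplices :=
  ⟨k, σ 0, by simp [bandGenerators], σ 1, by simp [bandGenerators], σ 2,
    by simp [bandGenerators], rfl, rfl⟩

theorem halfSimplex_mem (k : B4) : halfSimplex k ∈ simplices :=
  ⟨k * diagGen⁻¹, diagGen, by simp [bandGenerators, diagGen], σ 0, by simp [bandGenerators],
    σ 2, by simp [bandGenerators], diagGen_mul, by rw [inv_mul_cancel_right]; rfl⟩

/-- The sixteen factorizations form four orbits under rotation. One orbit gives the simplices
without short diagonal; the other three read the remaining simplices from each of their three
corners. -/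
theorem mem_simplices_iff {T : Set Vertex} :
    T ∈ simplices ↔ ∃ k, T = triSimplex k ∨ T = halfSimplex k := by
  constructor
  · rintro ⟨g, x, hx, y, hy, z, hz, e, rfl⟩
    obtain ⟨i, rfl⟩ := mem_bandGenerators_iff.1 hx
    obtain ⟨j, rfl⟩ := mem_bandGenerators_iff.1 hy
    obtain ⟨k, rfl⟩ := mem_bandGenerators_iff.1 hz
    have hm := mem_bandPairs e
    suffices SpansSimplex (band i) (band j) from this g
    have r4 := rot_pow_four
    have r2 := rot_rot_diagGen
    have t0 := spansSimplex_tri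
    have t1 := t0.rot
    have t2 := t1.rot
    have t3 := t2.rot
    have a0 := spansSimplex_half₁
    have a1 := a0.rot
    have a2 := a1.rot
    have a3 := a2.rot
    have b0 := spansSimplex_half₂
    have b1 := b0.rot
    have b2 := b1.rot
    have b3 := b2.rot
    have c0 := spansSimplex_half₃
    have c1 := c0.rot
    have c2 := c1.rot
    have c3 := c2.rot
    simp only [r4, r2] at *
    clear hx hy hz e
    simp only [bandPairs, List.mem_cons, Prod.mk.injEq, List.not_mem_nil, or_false] at hm
    rcases hm with ⟨rfl, rfl⟩ | ⟨rfl, rfl⟩ | ⟨rfl, rfl⟩ | ⟨rfl, rfl⟩ | ⟨rfl, rfl⟩ | ⟨rfl, rfl⟩ |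
      ⟨rfl, rfl⟩ | ⟨rfl, rfl⟩ | ⟨rfl, rfl⟩ | ⟨rfl, rfl⟩ | ⟨rfl, rfl⟩ | ⟨rfl, rfl⟩ | ⟨rfl, rfl⟩ |
      ⟨rfl, rfl⟩ | ⟨rfl, rfl⟩ | ⟨rfl, rfl⟩ <;> assumption
  · rintro ⟨k, rfl | rfl⟩
    exacts [triSimplex_mem k, halfSimplex_mem k]

theorem sides_triple {A B C : Vertex} (hAB : A ≠ B) (hBC : B ≠ C) (hCA : C ≠ A) :
    sides {A, B, C} = {s(A, B), s(B, C), s(C, A)} := by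
  ext e
  induction e with | _ x y
  simp only [sides, Set.mem_ofPred_eq, Sym2.mk_isDiag_iff, Sym2.mem_iff, Set.mem_insert_iff,
    Set.mem_singleton_iff, Sym2.eq_iff, forall_eq_or_imp, forall_eq]
  constructor
  · rintro ⟨h, rfl | rfl | rfl, rfl | rfl | rfl⟩ <;> simp_all
  · rintro ((⟨rfl, rfl⟩ | ⟨rfl, rfl⟩) | (⟨rfl, rfl⟩ | ⟨rfl, rfl⟩) | (⟨rfl, rfl⟩ | ⟨rfl, rfl⟩)) <;>
      simp_all [eq_comm]

theorem δ_pow_four_mul (x : B4) : δ ^ 4 * x = x * δ ^ 4 := by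
  refine (iff_of_invariant (P := fun x => δ ^ 4 * x = x * δ ^ 4) (fun k => ?_) (fun k => ?_) x 1).2
    (by simp)
  · rw [← mul_assoc, mul_assoc k, ← commute_δ_pow_four, ← mul_assoc k, mul_left_inj]
  · rw [← mul_assoc, mul_assoc k, (pow_mul_comm' δ 4).symm, ← mul_assoc k, mul_left_inj]

theorem δ_zpow_four_mul (m : ℤ) (x : B4) : δ ^ (4 * m) * x = x * δ ^ (4 * m) := by
  have h : Commute (δ ^ (4 : ℤ)) x := by exact_mod_cast δ_pow_four_mul x
  rw [zpow_mul]
  exact (h.zpow_left m).eq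

theorem edge_mul_right {k h : B4} (e : edge k = edge h) (x : B4) : edge (k * x) = edge (h * x) := by
  obtain ⟨m, rfl⟩ := edge_eq_iff.1 e
  rw [mul_assoc k, δ_zpow_four_mul, ← mul_assoc, edge_mul_zpow]

theorem vtx_mul_right {k h : B4} (e : edge k = edge h) (x : B4) : vtx (k * x) = vtx (h * x) := by
  obtain ⟨m, rfl⟩ := edge_eq_iff.1 e
  rw [mul_assoc k, δ_zpow_four_mul, ← mul_assoc, vtx_mul_zpow]

theorem δ_sq_mul_σ_zero : δ ^ 2 * σ 0 = σ 2 * δ ^ 2 := by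
  rw [pow_two, mul_assoc, δ_mul_σ_zero, ← mul_assoc, δ_mul_σ_one, mul_assoc]

theorem u_mul_σ_zero : u * σ 0 = σ 0 * σ 1 * δ := by
  rw [u, mul_assoc, δ_mul_σ_zero, mul_assoc]

theorem u_sq : u ^ 2 = σ 0 * σ 1 * δ ^ 2 := by
  rw [pow_two, pow_two]; nth_rw 2 [u]; rw [← mul_assoc, u_mul_σ_zero, mul_assoc]

theorem u_sq_mul_σ_zero : u ^ 2 * σ 0 = δ ^ 3 := by
  rw [u_sq, mul_assoc, δ_sq_mul_σ_zero, ← mul_assoc, pow_succ' δ 2]; rfl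

theorem u_cube : u ^ 3 = δ ^ 4 := by
  rw [pow_succ, u_sq, u, mul_assoc, ← mul_assoc _ (σ 0), δ_sq_mul_σ_zero, pow_succ' δ 3,
    pow_succ δ 2]
  simp only [← mul_assoc]; rfl

theorem q_mul_σ_zero : q * σ 0 = diagGen⁻¹ * δ ^ 3 := by
  rw [q, mul_assoc, δ_sq_mul_σ_zero, pow_succ' δ 2]; nth_rw 2 [← diagGen_mul]; group

theorem sides_triSimplex (k : B4) :
    sides (triSimplex k) = {edge k, edge (k * u), edge (k * u ^ 2)} := by
  have h1 : edge (k * u) = s(vtx (k * σ 0), vtx (k * σ 0 * σ 1)) := by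
    rw [edge, mul_assoc k, u_mul_σ_zero, u]
    simp only [← mul_assoc, vtx_mul_δ]
  have h2 : edge (k * u ^ 2) = s(vtx (k * σ 0 * σ 1), vtx k) := by
    rw [edge, mul_assoc k, u_sq_mul_σ_zero, u_sq]
    simp only [← mul_assoc, vtx_mul_pow]
  rw [h1, h2, triSimplex, sides_triple, edge] <;> (apply vtx_ne; simp [len_mul, len_σ]; try omega)

theorem sides_halfSimplex (k : B4) :
    sides (halfSimplex k) = {diag k, edge k, edge (k * q)} := by
  have h1 : edge (k * q) = s(vtx (k * σ 0), vtx (k * diagGen⁻¹)) := by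
    rw [edge, mul_assoc k, q_mul_σ_zero, q]
    simp only [← mul_assoc, vtx_mul_pow]
  rw [h1, halfSimplex, sides_triple, edge, diag] <;>
    (apply vtx_ne; simp [len_mul, len_inv, len_σ, len_diagGen])

theorem triSimplex_congr {k h : B4} (e : edge k = edge h) : triSimplex k = triSimplex h := by
  have := vtx_mul_right e
  have h1 := this 1
  rw [mul_one, mul_one] at h1
  rw [triSimplex, triSimplex, h1, this, mul_assoc, this, ← mul_assoc]

theorem triSimplex_mul_u (k : B4) : triSimplex (k * u) = triSimplex k := by
  have h2 : vtx (k * u * σ 0 * σ 1) = vtx k := by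
    rw [mul_assoc k, u_mul_σ_zero, mul_assoc, mul_assoc _ δ, δ_mul_σ_one, ← mul_assoc, ← mul_assoc,
      vtx_mul_δ, mul_assoc, ← δ, vtx_mul_δ]
  rw [triSimplex, h2, mul_assoc k, u_mul_σ_zero, u, triSimplex]
  simp only [← mul_assoc, vtx_mul_δ]
  ext v; simp only [Set.mem_insert_iff, Set.mem_singleton_iff]; tauto

theorem halfSimplex_congr {k h : B4} (e : edge k = edge h) : halfSimplex k = halfSimplex h := by
  have := vtx_mul_right e
  have h1 := this 1
  rw [mul_one, mul_one] at h1
  rw [halfSimplex, halfSimplex, h1, this, this]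

theorem edge_mem_sides_triSimplex {k h : B4} :
    edge k ∈ sides (triSimplex h) ↔ triSimplex h = triSimplex k := by
  constructor
  · rw [sides_triSimplex]
    rintro (e | e | e)
    · exact (triSimplex_congr e).symm
    · rw [triSimplex_congr e, triSimplex_mul_u]
    · rw [triSimplex_congr e, pow_two, ← mul_assoc, triSimplex_mul_u, triSimplex_mul_u]
  · intro e
    rw [e, sides_triSimplex]; exact Or.inl rfl

theorem edge_mem_sides_halfSimplex {k h : B4} :
    edge k ∈ sides (halfSimplex h) ↔
      halfSimplex h = halfSimplex k ∨ halfSimplex h = halfSimplex (k * q⁻¹) := by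
  constructor
  · rw [sides_halfSimplex]
    rintro (e | e | e)
    · exact (edge_ne_diag _ _ e).elim
    · exact Or.inl (halfSimplex_congr e).symm
    · refine Or.inr (halfSimplex_congr ?_)
      simpa using (edge_mul_right e q⁻¹).symm
  · rintro (e | e)
    · rw [e, sides_halfSimplex]; exact Or.inr (Or.inl rfl)
    · rw [e, sides_halfSimplex, inv_mul_cancel_right]; exact Or.inr (Or.inr rfl)

theorem diag_mem_sides_triSimplex (k h : B4) : diag k ∉ sides (triSimplex h) := by
  rw [sides_triSimplex]
  rintro (e | e | e) <;> exact edge_ne_diag _ _ e.symm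

theorem diag_mem_sides_halfSimplex (k : B4) : diag k ∈ sides (halfSimplex k) := by
  rw [sides_halfSimplex]; exact Or.inl rfl

theorem triSimplex_ne_halfSimplex (k h : B4) : triSimplex k ≠ halfSimplex h := fun e =>
  diag_mem_sides_triSimplex h k (e ▸ diag_mem_sides_halfSimplex h)

theorem halfSimplex_ne {k h : B4} (h1 : ¬ (12 : ℤ) ∣ len h - len k - 7)
    (h2 : ¬ (12 : ℤ) ∣ len h - len k) : halfSimplex k ≠ halfSimplex h := by
  intro e
  have : edge (k * q) ∈ sides (halfSimplex h) := by
    rw [← e, sides_halfSimplex]; exact Or.inr (Or.inr rfl)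
  rw [sides_halfSimplex] at this
  rcases this with e | e | e
  · exact edge_ne_diag _ _ e
  · exact edge_ne (by rw [len_mul, len_q]; omega) e
  · exact edge_ne (by rw [len_mul, len_mul, len_q]; omega) e

theorem order_edge (k : B4) : order (edge k) = 3 := by
  rw [order, Set.encard_eq_three]
  refine ⟨triSimplex k, halfSimplex k, halfSimplex (k * q⁻¹), triSimplex_ne_halfSimplex _ _,
    triSimplex_ne_halfSimplex _ _, halfSimplex_ne ?_ ?_, ?_⟩
  · rw [len_mul, len_inv, len_q]; omega
  · rw [len_mul, len_inv, len_q]; omega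
  ext T
  constructor
  · rintro ⟨hT, he⟩
    obtain ⟨h, rfl | rfl⟩ := mem_simplices_iff.1 hT
    · exact Or.inl (edge_mem_sides_triSimplex.1 he)
    · exact Or.inr (edge_mem_sides_halfSimplex.1 he)
  · rintro (rfl | rfl | rfl)
    · exact ⟨triSimplex_mem k, edge_mem_sides_triSimplex.2 rfl⟩
    · exact ⟨halfSimplex_mem k, edge_mem_sides_halfSimplex.2 (Or.inl rfl)⟩
    · exact ⟨halfSimplex_mem _, edge_mem_sides_halfSimplex.2 (Or.inr rfl)⟩

theorem diag_mem_sides_iff {k : B4} {T : Set Vertex} (hT : T ∈ simplices) :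
    diag k ∈ sides T ↔ T = halfSimplex k ∨ T = halfSimplex (k * δ ^ 2) := by
  constructor
  · intro he
    obtain ⟨h, rfl | rfl⟩ := mem_simplices_iff.1 hT
    · exact (diag_mem_sides_triSimplex _ _ he).elim
    · rw [sides_halfSimplex] at he
      rcases he with e | e | e
      · obtain ⟨m, rfl⟩ := diag_eq_iff.1 e
        obtain ⟨a, rfl | rfl⟩ := m.even_or_odd'
        -- A short diagonal determines its label up to powers of `δ ^ 2`, a half simplex only up to
        -- `δ ^ 4`; the parity of the exponent picks the half of the lozenge.
        · refine Or.inl (halfSimplex_congr ?_)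
          rw [← mul_assoc]; exact edge_mul_zpow k a
        · refine Or.inr (halfSimplex_congr ?_)
          rw [← edge_mul_zpow (k * δ ^ 2) a, mul_assoc, ← zpow_natCast, ← zpow_add]
          congr 3; push_cast; ring
      · exact (edge_ne_diag _ _ e.symm).elim
      · exact (edge_ne_diag _ _ e.symm).elim
  · rintro (rfl | rfl)
    · exact diag_mem_sides_halfSimplex k
    · rw [← diag_mul_sq]; exact diag_mem_sides_halfSimplex _

theorem halfSimplex_mul_sq_ne (k : B4) : halfSimplex k ≠ halfSimplex (k * δ ^ 2) :=
  halfSimplex_ne (by rw [len_mul, len_pow, len_δ]; omega) (by rw [len_mul, len_pow, len_δ]; omega)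

theorem order_diag (k : B4) : order (diag k) = 2 := by
  rw [order, Set.encard_eq_two]
  refine ⟨halfSimplex k, halfSimplex (k * δ ^ 2), halfSimplex_mul_sq_ne k, ?_⟩
  ext T
  constructor
  · rintro ⟨hT, he⟩
    exact (diag_mem_sides_iff hT).1 he
  · intro hT
    have : T ∈ simplices := by rcases hT with rfl | rfl <;> exact halfSimplex_mem _
    exact ⟨this, (diag_mem_sides_iff this).2 hT⟩

theorem eq_edge_or_diag {T : Set Vertex} (hT : T ∈ simplices) {e : Sym2 Vertex} (he : e ∈ sides T) :
    ∃ k, e = edge k ∨ e = diag k := by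
  obtain ⟨h, rfl | rfl⟩ := mem_simplices_iff.1 hT
  · rw [sides_triSimplex] at he
    rcases he with rfl | rfl | rfl <;> exact ⟨_, Or.inl rfl⟩
  · rw [sides_halfSimplex] at he
    rcases he with rfl | rfl | rfl
    exacts [⟨_, Or.inr rfl⟩, ⟨_, Or.inl rfl⟩, ⟨_, Or.inl rfl⟩]

theorem mem_edges_iff {e : Sym2 Vertex} : e ∈ edges ↔ ∃ k, e = edge k := by
  constructor
  · intro he
    have he' : order e = 3 := he
    have hne : order e ≠ 0 := by rw [he']; norm_num
    obtain ⟨T, hT, hs⟩ := Set.encard_ne_zero.1 hne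
    obtain ⟨k, rfl | rfl⟩ := eq_edge_or_diag hT hs
    · exact ⟨k, rfl⟩
    · rw [order_diag] at he'
      norm_num at he'
  · rintro ⟨k, rfl⟩
    exact order_edge k

/-! ### Triangles and lozenges, and the three faces at an edge. -/

/-- The boundary of the triangle of `X` on the edges `k`, `ku`, `ku²`. -/
def triangle (k : B4) : Set (Sym2 Vertex) := {edge k, edge (k * u), edge (k * u ^ 2)}

/-- The boundary of the lozenge of `X` on the edges `k`, `kδ²`, `kq`, `kδ²q`. -/
def lozenge (k : B4) : Set (Sym2 Vertex) :=
  {edge k, edge (k * δ ^ 2), edge (k * q), edge (k * δ ^ 2 * q)}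

theorem isTriangle_iff {f : Set (Sym2 Vertex)} : IsTriangle f ↔ ∃ k, f = triangle k := by
  constructor
  · rintro ⟨T, hT, hs, rfl⟩
    obtain ⟨k, rfl | rfl⟩ := mem_simplices_iff.1 hT
    · exact ⟨k, sides_triSimplex k⟩
    · obtain ⟨h, hh⟩ := mem_edges_iff.1 (hs (diag_mem_sides_halfSimplex k))
      exact (edge_ne_diag _ _ hh.symm).elim
  · rintro ⟨k, rfl⟩
    refine ⟨_, triSimplex_mem k, ?_, (sides_triSimplex k).symm⟩
    rw [sides_triSimplex]
    rintro e (rfl | rfl | rfl) <;> exact order_edge _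

theorem sides_union_diff (k : B4) :
    (sides (halfSimplex k) ∪ sides (halfSimplex (k * δ ^ 2))) \ {diag k} = lozenge k := by
  rw [sides_halfSimplex, sides_halfSimplex, diag_mul_sq, lozenge]
  ext e
  have h1 := fun h (he : e = edge h) => he ▸ edge_ne_diag h k
  simp only [Set.mem_sdiff, Set.mem_union, Set.mem_insert_iff, Set.mem_singleton_iff]
  constructor
  · tauto
  · rintro (h | h | h | h) <;> refine ⟨by tauto, h1 _ h⟩

theorem isLozenge_iff {f : Set (Sym2 Vertex)} : IsLozenge f ↔ ∃ k, f = lozenge k := by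
  constructor
  · rintro ⟨T, hT, T', hT', d, hne, hd, hd', ho, rfl⟩
    obtain ⟨k, rfl | rfl⟩ := eq_edge_or_diag hT hd
    · rw [order_edge] at ho; norm_num at ho
    · refine ⟨k, ?_⟩
      rw [← sides_union_diff]
      rcases (diag_mem_sides_iff hT).1 hd with rfl | rfl <;>
        rcases (diag_mem_sides_iff hT').1 hd' with rfl | rfl
      · exact (hne rfl).elim
      · rfl
      · rw [Set.union_comm]
      · exact (hne rfl).elim
  · rintro ⟨k, rfl⟩
    exact ⟨_, halfSimplex_mem k, _, halfSimplex_mem (k * δ ^ 2), diag k, halfSimplex_mul_sq_ne k,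
      diag_mem_sides_halfSimplex k, (diag_mem_sides_iff (halfSimplex_mem _)).2 (Or.inr rfl),
      order_diag k, (sides_union_diff k).symm⟩

theorem mem_faces_iff {f : Set (Sym2 Vertex)} :
    f ∈ faces ↔ ∃ k, f = triangle k ∨ f = lozenge k := by
  rw [exists_or, ← isTriangle_iff, ← isLozenge_iff]; rfl

theorem triangle_congr {k h : B4} (e : edge k = edge h) : triangle k = triangle h := by
  rw [triangle, triangle, e, edge_mul_right e, edge_mul_right e]

theorem triangle_mul_u (k : B4) : triangle (k * u) = triangle k := by
  have h : k * u * u ^ 2 = k * δ ^ 4 := by rw [← u_cube, mul_assoc, ← pow_succ']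
  rw [triangle, triangle, h, edge_mul_pow_four, mul_assoc, ← pow_two]
  ext v; simp only [Set.mem_insert_iff, Set.mem_singleton_iff]; tauto

theorem lozenge_congr {k h : B4} (e : edge k = edge h) : lozenge k = lozenge h := by
  rw [lozenge, lozenge, e, edge_mul_right e, edge_mul_right e, mul_assoc, edge_mul_right e,
    ← mul_assoc]

theorem edge_mul_sq_sq (k : B4) : edge (k * δ ^ 2 * δ ^ 2) = edge k := by
  rw [mul_assoc, ← pow_add, edge_mul_pow_four]

theorem lozenge_mul_sq (k : B4) : lozenge (k * δ ^ 2) = lozenge k := by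
  rw [lozenge, lozenge, edge_mul_right (edge_mul_sq_sq k), edge_mul_sq_sq]
  ext v; simp only [Set.mem_insert_iff, Set.mem_singleton_iff]; tauto

theorem edge_mem_triangle {k h : B4} : edge k ∈ triangle h ↔ triangle h = triangle k := by
  constructor
  · rintro (e | e | e)
    · exact (triangle_congr e).symm
    · rw [triangle_congr e, triangle_mul_u]
    · rw [triangle_congr e, pow_two, ← mul_assoc, triangle_mul_u, triangle_mul_u]
  · intro e
    rw [e]; exact Or.inl rfl

theorem edge_mem_lozenge {k h : B4} :
    edge k ∈ lozenge h ↔ lozenge h = lozenge k ∨ lozenge h = lozenge (k * q⁻¹) := by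
  constructor
  · rintro (e | e | e | e)
    · exact Or.inl (lozenge_congr e).symm
    · exact Or.inl (by rw [lozenge_congr e, lozenge_mul_sq])
    · refine Or.inr ?_
      rw [lozenge_congr (edge_mul_right e q⁻¹), mul_inv_cancel_right]
    · refine Or.inr ?_
      rw [lozenge_congr (edge_mul_right e q⁻¹), mul_inv_cancel_right, lozenge_mul_sq]
  · rintro (e | e) <;> rw [e, lozenge]
    · exact Or.inl rfl
    · rw [inv_mul_cancel_right]; exact Or.inr (Or.inr (Or.inl rfl))

theorem triangle_ne_lozenge (k h : B4) : triangle k ≠ lozenge h := by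
  intro e
  have h1 : edge h ∈ triangle k := by rw [e]; exact Or.inl rfl
  have h2 : edge (h * u) ∈ lozenge h := by
    rw [← e, edge_mem_triangle, triangle_mul_u]; exact edge_mem_triangle.1 h1
  rcases h2 with e | e | e | e <;> refine edge_ne ?_ e <;>
    simp only [len_mul, len_pow, len_q, len_u, len_δ] <;> omega

/-- Modulo 12 the edges of `lozenge h` have exponent sums exceeding that of `h` by 0, 6, 7, 1. The
only members of this list whose shift by 7 is again in it are 0 and 6. -/
theorem len_of_lozenge_eq {k h : B4} (e : lozenge k = lozenge h) : (6 : ℤ) ∣ len k - len h := by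
  have h1 : edge k ∈ lozenge h := by rw [← e]; exact Or.inl rfl
  have h2 : edge (k * q) ∈ lozenge h := by rw [← e]; exact Or.inr (Or.inr (Or.inl rfl))
  by_contra hn
  rcases h1 with e1 | e1 | e1 | e1 <;> rcases h2 with e2 | e2 | e2 | e2 <;>
    obtain ⟨m, hm⟩ := edge_eq_iff.1 e1 <;> obtain ⟨m', hm'⟩ := edge_eq_iff.1 e2 <;>
    replace hm := congrArg len hm <;> replace hm' := congrArg len hm' <;>
    simp only [len_mul, len_pow, len_zpow, len_q, len_δ] at hm hm' <;> omega

theorem lozenge_ne (k : B4) : lozenge k ≠ lozenge (k * q⁻¹) := by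
  intro e
  have := len_of_lozenge_eq e
  rw [len_mul, len_inv, len_q] at this
  omega

theorem face_at_edge {f : Set (Sym2 Vertex)} (hf : f ∈ faces) (k : B4) :
    edge k ∈ f ↔ f = triangle k ∨ f = lozenge k ∨ f = lozenge (k * q⁻¹) := by
  obtain ⟨h, rfl | rfl⟩ := mem_faces_iff.1 hf
  · rw [edge_mem_triangle]
    have := triangle_ne_lozenge h
    simp [this]
  · rw [edge_mem_lozenge]
    have := (triangle_ne_lozenge k h).symm
    simp [this]

theorem encard_faces_at_edge {S : Set (Set (Sym2 Vertex))} (hS : S ⊆ faces) (k : B4) :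
    {f | f ∈ S ∧ edge k ∈ f}.encard = 2 ↔
      (triangle k ∉ S ∧ lozenge k ∈ S ∧ lozenge (k * q⁻¹) ∈ S) ∨
      (triangle k ∈ S ∧ lozenge k ∉ S ∧ lozenge (k * q⁻¹) ∈ S) ∨
      (triangle k ∈ S ∧ lozenge k ∈ S ∧ lozenge (k * q⁻¹) ∉ S) := by
  have hset : {f | f ∈ S ∧ edge k ∈ f} =
      S ∩ {triangle k, lozenge k, lozenge (k * q⁻¹)} := by
    ext f
    exact and_congr_right fun hf => face_at_edge (hS hf) k
  have n1 := triangle_ne_lozenge k k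
  have n2 := triangle_ne_lozenge k (k * q⁻¹)
  have n3 := lozenge_ne k
  rw [hset]
  by_cases h1 : triangle k ∈ S <;> by_cases h2 : lozenge k ∈ S <;>
    by_cases h3 : lozenge (k * q⁻¹) ∈ S <;>
    simp [Set.inter_insert_of_mem, Set.inter_insert_of_notMem, h1, h2, h3, n1, n2,
      n3, Set.encard_insert_of_notMem] <;> norm_num

variable {S : Set (Set (Sym2 Vertex))}

/-! ### Corners of faces at the two ends of an edge. -/

theorem vtx_mem_edge {g h : B4} (hm : vtx g ∈ edge h) :
    (vtx g = vtx h ∧ (3 : ℤ) ∣ len g - len h) ∨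
      (vtx g = vtx (h * σ 0) ∧ (3 : ℤ) ∣ len g - len h - 1) := by
  rcases vtx_eq_or_of_mem_edge.1 hm with e | e
  · refine Or.inl ⟨e, ?_⟩
    by_contra hn
    exact vtx_ne (by omega) e
  · refine Or.inr ⟨e, ?_⟩
    by_contra hn
    exact vtx_ne (by rw [len_mul, len_σ]; omega) e

theorem vtx_sq_mul_ne (h : B4) : vtx (h * σ 0) ≠ vtx (h * δ ^ 2 * σ 0) := by
  intro e
  have : edge h = edge (h * δ ^ 2) := by rw [edge, edge, e, vtx_mul_pow]
  exact edge_ne (by rw [len_mul, len_pow, len_δ]; omega) this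

theorem vtx_mul_q_inv_mul_σ_zero (k : B4) : vtx (k * q⁻¹ * σ 0) = vtx k := by
  rw [← vtx_mul_pow _ 2]; congr 1; rw [q]; group

theorem edge_u_inv (k : B4) : edge (k * u ^ 2) = edge (k * u⁻¹) := by
  rw [← edge_mul_pow_four (k * u⁻¹), ← u_cube]; congr 1; group

theorem corner_out {f : Set (Sym2 Vertex)} (hf : f ∈ faces) {k : B4} (hk : edge k ∈ f)
    {e : Sym2 Vertex} (he : e ∈ f) (hv : vtx k ∈ e) :
    e = edge k ∨ (f = triangle k ∧ e = edge (k * u⁻¹)) ∨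
      (f = lozenge k ∧ e = edge (k * δ ^ 2)) ∨
      (f = lozenge (k * q⁻¹) ∧ e = edge (k * q⁻¹)) := by
  rcases (face_at_edge hf k).1 hk with rfl | rfl | rfl
  · rcases he with rfl | rfl | rfl
    · exact Or.inl rfl
    · exfalso
      rcases vtx_mem_edge hv with ⟨-, hl⟩ | ⟨-, hl⟩ <;> rw [len_mul, len_u] at hl <;> omega
    · exact Or.inr (Or.inl ⟨rfl, edge_u_inv k⟩)
  · rcases he with rfl | rfl | rfl | rfl
    · exact Or.inl rfl
    · exact Or.inr (Or.inr (Or.inl ⟨rfl, rfl⟩))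
    · exfalso
      rcases vtx_mem_edge hv with ⟨-, hl⟩ | ⟨-, hl⟩ <;>
        simp only [len_mul, len_q] at hl <;> omega
    · exfalso
      rcases vtx_mem_edge hv with ⟨-, hl⟩ | ⟨-, hl⟩ <;>
        simp only [len_mul, len_q, len_pow, len_δ] at hl <;> omega
  · rcases he with rfl | rfl | rfl | rfl
    · exact Or.inr (Or.inr (Or.inr ⟨rfl, rfl⟩))
    · exfalso
      rcases vtx_mem_edge hv with ⟨-, hl⟩ | ⟨hv', -⟩
      · simp only [len_mul, len_inv, len_q, len_pow, len_δ] at hl; omega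
      · rw [← vtx_mul_q_inv_mul_σ_zero k] at hv'
        exact vtx_sq_mul_ne _ hv'
    · exact Or.inl (by rw [inv_mul_cancel_right])
    · exfalso
      rcases vtx_mem_edge hv with ⟨hv', -⟩ | ⟨-, hl⟩
      · rw [← vtx_mul_q_inv_mul_σ_zero k, q, ← mul_assoc (_ * _), vtx_mul_pow] at hv'
        exact vtx_sq_mul_ne _ hv'
      · simp only [len_mul, len_inv, len_q, len_pow, len_δ] at hl; omega

theorem corner_in {f : Set (Sym2 Vertex)} (hf : f ∈ faces) {k : B4} (hk : edge k ∈ f)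
    {e : Sym2 Vertex} (he : e ∈ f) (hv : vtx (k * σ 0) ∈ e) :
    e = edge k ∨ (f = triangle k ∧ e = edge (k * u)) ∨
      (f = lozenge k ∧ e = edge (k * q)) ∨
      (f = lozenge (k * q⁻¹) ∧ e = edge (k * q⁻¹ * δ ^ 2 * q)) := by
  rcases (face_at_edge hf k).1 hk with rfl | rfl | rfl
  · rcases he with rfl | rfl | rfl
    · exact Or.inl rfl
    · exact Or.inr (Or.inl ⟨rfl, rfl⟩)
    · exfalso
      rcases vtx_mem_edge hv with ⟨-, hl⟩ | ⟨-, hl⟩ <;>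
        simp only [len_mul, len_pow, len_u, len_σ] at hl <;> omega
  · rcases he with rfl | rfl | rfl | rfl
    · exact Or.inl rfl
    · exfalso
      rcases vtx_mem_edge hv with ⟨-, hl⟩ | ⟨hv', -⟩
      · simp only [len_mul, len_σ, len_pow, len_δ] at hl; omega
      · exact vtx_sq_mul_ne _ hv'
    · exact Or.inr (Or.inr (Or.inl ⟨rfl, rfl⟩))
    · exfalso
      rcases vtx_mem_edge hv with ⟨hv', -⟩ | ⟨-, hl⟩
      · rw [q, ← mul_assoc (_ * _), vtx_mul_pow] at hv'
        exact vtx_sq_mul_ne _ hv'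
      · simp only [len_mul, len_σ, len_q, len_pow, len_δ] at hl; omega
  · rcases he with rfl | rfl | rfl | rfl
    · exfalso
      rcases vtx_mem_edge hv with ⟨-, hl⟩ | ⟨-, hl⟩ <;>
        simp only [len_mul, len_inv, len_q, len_σ] at hl <;> omega
    · exfalso
      rcases vtx_mem_edge hv with ⟨-, hl⟩ | ⟨-, hl⟩ <;>
        simp only [len_mul, len_inv, len_q, len_σ, len_pow, len_δ] at hl <;> omega
    · exact Or.inl (by rw [inv_mul_cancel_right])
    · exact Or.inr (Or.inr (Or.inr ⟨rfl, rfl⟩))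

/-- Identifies the second incoming edge at an obtuse corner: on incoming edges `gδⁿσ₁⁻¹`, as on
outgoing ones, an obtuse corner shifts `n` by 2. -/
theorem σ_zero_inv_mul_conj : (σ 0)⁻¹ * q⁻¹ * δ ^ 2 * q = δ ^ 2 * (σ 0)⁻¹ := by
  have h : (σ 0)⁻¹ * q⁻¹ * δ ^ 2 * q = (σ 0)⁻¹ * (δ ^ 2)⁻¹ * (σ 0)⁻¹ * (δ ^ 2 * σ 0) * δ ^ 2 := by
    rw [q]; group
  have h2 : (δ ^ 2)⁻¹ * (σ 0)⁻¹ = (σ 2)⁻¹ * (δ ^ 2)⁻¹ := by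
    rw [← mul_inv_rev, ← mul_inv_rev, δ_sq_mul_σ_two]
  have h3 : (σ 0)⁻¹ * (σ 2)⁻¹ = (σ 2)⁻¹ * (σ 0)⁻¹ := by
    rw [← mul_inv_rev, ← mul_inv_rev, commute_zero_two]
  have h4 : (σ 2)⁻¹ * δ ^ 2 = δ ^ 2 * (σ 0)⁻¹ := by
    rw [inv_mul_eq_iff_eq_mul, ← mul_assoc, eq_mul_inv_iff_mul_eq, δ_sq_mul_σ_zero]
  rw [h, mul_assoc (σ 0)⁻¹, h2, ← mul_assoc (σ 0)⁻¹, h3, ← h4]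
  group

/-! ### Consequences of a connected link. -/

/-- A property of the edges of `X` at `v` that passes from one edge of each corner of `S` at `v`
to the other holds at all of them if it holds at one and the link is connected. -/
theorem link_propagate {v : Vertex} (hc : (link S v).Connected) {P : Sym2 Vertex → Prop}
    (step : ∀ f ∈ S, ∀ e ∈ f, ∀ e' ∈ f, v ∈ e → v ∈ e' → P e → P e')
    {e e' : Sym2 Vertex} (he : e ∈ edges) (hv : v ∈ e) (he' : e' ∈ edges) (hv' : v ∈ e')
    (hP : P e) : P e' := by
  have hr := (SimpleGraph.reachable_iff_reflTransGen _ _).1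
    (hc.preconnected ⟨e, he, hv⟩ ⟨e', he', hv'⟩)
  suffices ∀ x, Relation.ReflTransGen (link S v).Adj ⟨e, he, hv⟩ x → P x.1 from this _ hr
  intro x hx
  induction hx with
  | refl => exact hP
  | @tail x y _ hxy ih =>
    obtain ⟨-, f, hf, hxf, hyf⟩ := hxy
    exact step f hf _ hxf _ hyf x.2.2 y.2.2 ih

theorem vtx_mem_edge_mul_zpow (g : B4) (n : ℤ) : vtx g ∈ edge (g * δ ^ n) :=
  vtx_eq_or_of_mem_edge.2 (Or.inl (vtx_mul_zpow g n).symm)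

theorem vtx_mem_edge_mul_zpow_inv (g : B4) (n : ℤ) : vtx g ∈ edge (g * δ ^ n * (σ 0)⁻¹) :=
  vtx_eq_or_of_mem_edge.2 (Or.inr (by rw [inv_mul_cancel_right, vtx_mul_zpow]))

theorem edge_mem_edges (k : B4) : edge k ∈ edges := mem_edges_iff.2 ⟨k, rfl⟩

theorem mul_u_inv_eq (g : B4) (n : ℤ) : g * δ ^ n * u⁻¹ = g * δ ^ (n - 1) * (σ 0)⁻¹ := by
  rw [u]; group
theorem mul_q_inv_eq (g : B4) (n : ℤ) : g * δ ^ n * q⁻¹ = g * δ ^ (n - 2) * (σ 0)⁻¹ := by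
  rw [q]; group
theorem mul_sq_eq (g : B4) (n : ℤ) : g * δ ^ n * δ ^ 2 = g * δ ^ (n + 2) := by group
theorem inv_mul_u_eq (g : B4) (n : ℤ) : g * δ ^ n * (σ 0)⁻¹ * u = g * δ ^ (n + 1) := by
  rw [u]; group
theorem inv_mul_q_eq (g : B4) (n : ℤ) : g * δ ^ n * (σ 0)⁻¹ * q = g * δ ^ (n + 2) := by
  rw [q]; group
theorem inv_mul_conj_eq (g : B4) (n : ℤ) :
    g * δ ^ n * (σ 0)⁻¹ * q⁻¹ * δ ^ 2 * q = g * δ ^ (n + 2) * (σ 0)⁻¹ := by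
  rw [← mul_sq_eq, mul_assoc _ (δ ^ 2) (σ 0)⁻¹, ← σ_zero_inv_mul_conj]; simp only [mul_assoc]

/-- The lozenges in question are those with an acute corner at `g`. Every other corner preserves the
class of outgoing edges with even `n` and incoming edges with odd `n`, so without acute corners the
link would split. -/
theorem exists_lozenge_mem (hS : IsHamiltonianSurface S) (g : B4) :
    ∃ n : ℤ, lozenge (g * δ ^ n * (σ 0)⁻¹) ∈ S := by
  by_contra! hn
  have := link_propagate (hS.link_connected (vtx g))
    (P := fun e => ∃ m : ℤ, e = edge (g * δ ^ (2 * m)) ∨ e = edge (g * δ ^ (2 * m + 1) * (σ 0)⁻¹))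
    ?_ (edge_mem_edges _) (vtx_mem_edge_mul_zpow g 0) (edge_mem_edges _)
    (vtx_mem_edge_mul_zpow g 1) ⟨0, Or.inl (by simp)⟩
  · obtain ⟨m, e | e⟩ := this <;> refine edge_ne ?_ e <;>
      simp only [len_mul, len_zpow, len_δ, len_inv, len_σ] <;> omega
  · rintro f hf _ he e' he' - hv' ⟨m, rfl | rfl⟩
    · rw [← vtx_mul_zpow g (2 * m)] at hv'
      rcases corner_out (hS.subset_faces hf) he he' hv' with rfl | ⟨-, rfl⟩ | ⟨-, rfl⟩ | ⟨rfl, -⟩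
      · exact ⟨m, Or.inl rfl⟩
      · exact ⟨m - 1, Or.inr (by rw [mul_u_inv_eq]; congr 4; ring)⟩
      · exact ⟨m + 1, Or.inl (by rw [mul_sq_eq]; congr 3; ring)⟩
      · rw [mul_q_inv_eq] at hf
        exact (hn _ hf).elim
    · rw [← vtx_mul_zpow g (2 * m + 1), ← inv_mul_cancel_right (g * _) (σ 0)] at hv'
      rcases corner_in (hS.subset_faces hf) he he' hv' with rfl | ⟨-, rfl⟩ | ⟨rfl, -⟩ | ⟨-, rfl⟩
      · exact ⟨m, Or.inr rfl⟩
      · exact ⟨m + 1, Or.inl (by rw [inv_mul_u_eq]; congr 3; ring)⟩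
      · exact (hn _ hf).elim
      · exact ⟨m + 1, Or.inr (by rw [inv_mul_conj_eq]; congr 4; ring)⟩

/-- Lozenge corners never change the parity of `n`, on outgoing or incoming edges; only triangle
corners can connect even to odd. -/
theorem exists_triangle_mem (hS : IsHamiltonianSurface S) (g : B4) :
    ∃ n : ℤ, triangle (g * δ ^ n) ∈ S := by
  by_contra! hn
  have := link_propagate (hS.link_connected (vtx g))
    (P := fun e => ∃ m : ℤ, e = edge (g * δ ^ (2 * m)) ∨ e = edge (g * δ ^ (2 * m) * (σ 0)⁻¹))
    ?_ (edge_mem_edges _) (vtx_mem_edge_mul_zpow g 0) (edge_mem_edges _)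
    (vtx_mem_edge_mul_zpow g 1) ⟨0, Or.inl (by simp)⟩
  · obtain ⟨m, e | e⟩ := this <;> refine edge_ne ?_ e <;>
      simp only [len_mul, len_zpow, len_δ, len_inv, len_σ] <;> omega
  · rintro f hf _ he e' he' - hv' ⟨m, rfl | rfl⟩
    · rw [← vtx_mul_zpow g (2 * m)] at hv'
      rcases corner_out (hS.subset_faces hf) he he' hv' with rfl | ⟨rfl, -⟩ | ⟨-, rfl⟩ | ⟨-, rfl⟩
      · exact ⟨m, Or.inl rfl⟩
      · exact (hn _ hf).elim
      · exact ⟨m + 1, Or.inl (by rw [mul_sq_eq]; congr 3; ring)⟩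
      · exact ⟨m - 1, Or.inr (by rw [mul_q_inv_eq]; congr 4; ring)⟩
    · rw [← vtx_mul_zpow g (2 * m), ← inv_mul_cancel_right (g * _) (σ 0)] at hv'
      rcases corner_in (hS.subset_faces hf) he he' hv' with rfl | ⟨rfl, -⟩ | ⟨-, rfl⟩ | ⟨-, rfl⟩
      · exact ⟨m, Or.inr rfl⟩
      · rw [← triangle_mul_u, inv_mul_u_eq] at hf
        exact (hn _ hf).elim
      · exact ⟨m + 1, Or.inl (by rw [inv_mul_q_eq]; congr 3; ring)⟩
      · exact ⟨m + 1, Or.inr (by rw [inv_mul_conj_eq]; congr 4; ring)⟩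

/-! ### Perfect matchings of the link. -/

/-- Exactly one of three propositions fails. -/
def OneFails (a b c : Prop) : Prop := (¬ a ∧ b ∧ c) ∨ (a ∧ ¬ b ∧ c) ∨ (a ∧ b ∧ ¬ c)

/-- The perfect matchings of the link of a vertex whose complement is connected. -/
theorem matching_of_link {T A R K : ℤ → Prop} (hT : Function.Periodic T 4)
    (hA : Function.Periodic A 4) (hR : Function.Periodic R 2) (hK : Function.Periodic K 2)
    (hout : ∀ n, OneFails (T n) (R n) (A (n - 2))) (hin : ∀ n, OneFails (T (n + 1)) (A n) (K n))
    (eT : ∃ n, T n) (eA : ∃ n, A n) :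
    (¬ A 0 → ¬ R 1) ∧ (¬ T 0 → ¬ R 1 ∧ A 0) := by
  -- By periodicity only `n = 0, 1, 2, 3` matter, and the claim becomes a finite propositional
  -- problem. `T`, `A`, `R`, `K` record the presence of triangle corners, acute corners, and obtuse
  -- corners between outgoing and between incoming edges.
  have red : ∀ {F : ℤ → Prop}, Function.Periodic F 4 → (∃ n, F n) → F 0 ∨ F 1 ∨ F 2 ∨ F 3 := by
    rintro F hF ⟨n, hn⟩
    have h : F (n % 4) = F n := by
      have := hF.int_mul (n / 4) (n % 4)
      rw [← this]; congr 1; simp; omega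
    rw [← h] at hn
    have : n % 4 = 0 ∨ n % 4 = 1 ∨ n % 4 = 2 ∨ n % 4 = 3 := by omega
    rcases this with e | e | e | e <;> rw [e] at hn <;> tauto
  have eT' := red hT eT
  have eA' := red hA eA
  have o0 := hout 0
  have o1 := hout 1
  have o2 := hout 2
  have o3 := hout 3
  have i0 := hin 0
  have i1 := hin 1
  have i2 := hin 2
  have i3 := hin 3
  have a2 := hA (-2)
  have a3 := hA (-1)
  have t0 := hT 0
  have r0 := hR 0
  have r1 := hR 1
  have k0 := hK 0
  have k1 := hK 1
  norm_num at *
  clear hout hin eT eA hT hA hR hK red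
  rw [← a2] at o0
  rw [← a3] at o1
  rw [r0] at o2
  rw [r1] at o3
  rw [k0] at i2
  rw [k1, t0] at i3
  clear a2 a3 t0 r0 r1 k0 k1
  simp only [OneFails] at *
  grind

theorem oneFails_of_surface (hS : IsEnvelopingSurface S) (k : B4) :
    OneFails (triangle k ∈ S) (lozenge k ∈ S) (lozenge (k * q⁻¹) ∈ S) :=
  (encard_faces_at_edge hS.subset_faces k).1 (hS.two_faces _ (edge_mem_edges k))

theorem edge_add_four (g x : B4) (n : ℤ) :
    edge (g * δ ^ (n + 4) * x) = edge (g * δ ^ n * x) := by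
  refine edge_mul_right ?_ x
  rw [← edge_mul_pow_four (g * δ ^ n)]; congr 1; group

theorem lozenge_add_two (g : B4) (n : ℤ) :
    lozenge (g * δ ^ (n + 2)) = lozenge (g * δ ^ n) := by
  rw [← mul_sq_eq, lozenge_mul_sq]

theorem lozenge_conj_add_two (g : B4) (n : ℤ) :
    lozenge (g * δ ^ (n + 2) * (σ 0)⁻¹ * q⁻¹) = lozenge (g * δ ^ n * (σ 0)⁻¹ * q⁻¹) := by
  rw [← inv_mul_conj_eq, mul_inv_cancel_right, lozenge_mul_sq]

theorem matching_of_surface (hS : IsHamiltonianSurface S) (g : B4) :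
    (lozenge (g * (σ 0)⁻¹) ∉ S → lozenge (g * δ) ∉ S) ∧
      (triangle g ∉ S → lozenge (g * δ) ∉ S ∧ lozenge (g * (σ 0)⁻¹) ∈ S) := by
  have := matching_of_link (T := fun n => triangle (g * δ ^ n) ∈ S)
    (A := fun n => lozenge (g * δ ^ n * (σ 0)⁻¹) ∈ S) (R := fun n => lozenge (g * δ ^ n) ∈ S)
    (K := fun n => lozenge (g * δ ^ n * (σ 0)⁻¹ * q⁻¹) ∈ S)
    (fun n => by
      have := triangle_congr (edge_add_four g 1 n)
      simp only [mul_one] at this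
      simp only [this])
    (fun n => by simp only [lozenge_congr (edge_add_four g _ n)])
    (fun n => by simp only [lozenge_add_two])
    (fun n => by simp only [lozenge_conj_add_two])
    (fun n => by rw [← mul_q_inv_eq]; exact oneFails_of_surface hS.toIsEnvelopingSurface _)
    (fun n => by
      rw [← inv_mul_u_eq, triangle_mul_u]; exact oneFails_of_surface hS.toIsEnvelopingSurface _)
    (exists_triangle_mem hS g) (exists_lozenge_mem hS g)
  simpa using this

/-! ### One lozenge determines the surface. -/

/-- At the head of the edge `k`, `lozenge k` has an acute corner and `lozenge (k * u)` an obtuse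
one. The chord joins the outgoing edges 1 and 3, and any admissible matching omitting the acute
corner 0 omits it too. -/
theorem lozenge_mul_u_mem (hS : IsHamiltonianSurface S) {k : B4} (h : lozenge (k * u) ∈ S) :
    lozenge k ∈ S := by
  by_contra hn
  have := (matching_of_surface hS (k * σ 0)).1 (by rwa [mul_inv_cancel_right])
  rw [mul_assoc] at this
  exact this h

theorem lozenge_mul_u_mem_iff (hS : IsHamiltonianSurface S) (k : B4) :
    lozenge (k * u) ∈ S ↔ lozenge k ∈ S := by
  refine ⟨lozenge_mul_u_mem hS, fun h => ?_⟩
  apply lozenge_mul_u_mem hS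
  apply lozenge_mul_u_mem hS
  have : k * u * u * u = k * δ ^ 4 := by rw [← u_cube, pow_three']; simp only [mul_assoc]
  rwa [this, lozenge_congr (edge_mul_pow_four k)]

/-- An omitted triangle would separate the lozenges of `kσ₁⁻¹` and `kσ₁⁻¹u = kδ`, against invariance
under `u`. -/
theorem triangle_mem (hS : IsHamiltonianSurface S) (k : B4) : triangle k ∈ S := by
  by_contra hn
  obtain ⟨h1, h2⟩ := (matching_of_surface hS k).2 hn
  refine h1 ?_
  rw [← lozenge_mul_u_mem_iff hS] at h2
  convert h2 using 2
  rw [u]; group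

/-- Since all triangles are present, exactly one of the two lozenges at the edge `kδ` is. The other
one is `lozenge (kδq⁻¹)`, and `q = uδ` makes it equivalent to `lozenge k` under the invariance. -/
theorem lozenge_mul_δ_mem_iff (hS : IsHamiltonianSurface S) (k : B4) :
    lozenge (k * δ) ∈ S ↔ lozenge k ∉ S := by
  have h1 := oneFails_of_surface hS.toIsEnvelopingSurface (k * δ)
  have h2 := triangle_mem hS (k * δ)
  have h3 := lozenge_mul_u_mem_iff hS (k * δ * q⁻¹)
  have h4 : lozenge (k * δ * q⁻¹ * u) = lozenge k := by
    have hq : q = u * δ := by rw [q, u, pow_two, mul_assoc]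
    rw [hq]; congr 1; group
  rw [h4] at h3
  simp only [OneFails] at h1
  tauto

theorem lozenge_mem_iff (hS : IsHamiltonianSurface S) {g : B4} (hg : lozenge g ∈ S) (k : B4) :
    lozenge k ∈ S ↔ Even (len k - len g) := by
  have hδ := lozenge_mul_δ_mem_iff hS
  have := iff_of_invariant (P := fun k => lozenge k ∈ S ↔ Even (len k - len g))
    (fun k => by
      have h1 := hδ (k * σ 0)
      rw [mul_assoc, ← u, lozenge_mul_u_mem_iff hS] at h1
      have h2 : len (k * σ 0) - len g = len k - len g + 1 := by rw [len_mul, len_σ]; ring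
      rw [h2, Int.even_add_one]
      tauto)
    (fun k => by
      have h1 := hδ k
      have h2 : len (k * δ) - len g = len k - len g + 1 + 2 := by rw [len_mul, len_δ]; ring
      rw [h2, Int.even_add, Int.even_add_one]
      simp only [even_two, iff_true]
      tauto) g k
  exact this.1 (by simpa using hg)

/-! ### Existence: the surface of a given parity. -/

/-- The surface formed by all triangles of `X` and the lozenges with the parity of `g`. -/
def paritySurface (g : B4) : Set (Set (Sym2 Vertex)) :=
  {f | (∃ k, f = triangle k) ∨ ∃ k, Even (len k - len g) ∧ f = lozenge k}

theorem triangle_mem_paritySurface (g k : B4) : triangle k ∈ paritySurface g := Or.inl ⟨k, rfl⟩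

theorem lozenge_mem_paritySurface {g k : B4} :
    lozenge k ∈ paritySurface g ↔ Even (len k - len g) := by
  constructor
  · rintro (⟨h, e⟩ | ⟨h, he, e⟩)
    · exact (triangle_ne_lozenge _ _ e.symm).elim
    · have := len_of_lozenge_eq e
      rw [Int.even_iff] at he ⊢
      omega
  · exact fun h => Or.inr ⟨k, h, rfl⟩

theorem eq_paritySurface (hS : IsHamiltonianSurface S) {g : B4} (hg : lozenge g ∈ S) :
    S = paritySurface g := by
  ext f
  constructor
  · intro hf
    obtain ⟨k, rfl | rfl⟩ := mem_faces_iff.1 (hS.subset_faces hf)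
    · exact triangle_mem_paritySurface g k
    · exact lozenge_mem_paritySurface.2 ((lozenge_mem_iff hS hg k).1 hf)
  · rintro (⟨k, rfl⟩ | ⟨k, hk, rfl⟩)
    · exact triangle_mem hS k
    · exact (lozenge_mem_iff hS hg k).2 hk

theorem paritySurface_subset (g : B4) : paritySurface g ⊆ faces := by
  rintro f (⟨k, rfl⟩ | ⟨k, -, rfl⟩)
  exacts [mem_faces_iff.2 ⟨k, Or.inl rfl⟩, mem_faces_iff.2 ⟨k, Or.inr rfl⟩]

theorem paritySurface_two_faces (g : B4) {e : Sym2 Vertex} (he : e ∈ edges) :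
    {f | f ∈ paritySurface g ∧ e ∈ f}.encard = 2 := by
  obtain ⟨k, rfl⟩ := mem_edges_iff.1 he
  rw [encard_faces_at_edge (paritySurface_subset g)]
  have h := triangle_mem_paritySurface g k
  -- The exponent sum 7 of `q` is odd, so the two lozenges at an edge have opposite parities.
  have h2 : lozenge (k * q⁻¹) ∈ paritySurface g ↔ lozenge k ∉ paritySurface g := by
    rw [lozenge_mem_paritySurface, lozenge_mem_paritySurface, len_mul, len_inv, len_q,
      Int.even_iff, Int.even_iff]
    omega
  tauto

/-- If all links of a set of faces are connected, then so is the set of faces. -/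
theorem faces_connected (hS : S ⊆ faces) (hc : ∀ v, (link S v).Connected)
    {f f' : Set (Sym2 Vertex)} (hf : f ∈ S) (hf' : f' ∈ S) :
    Relation.ReflTransGen (fun a b => a ∈ S ∧ b ∈ S ∧ (a ∩ b).Nonempty) f f' := by
  let P : Sym2 Vertex → Prop := fun e => ∀ f₁ ∈ S, e ∈ f₁ →
    Relation.ReflTransGen (fun a b => a ∈ S ∧ b ∈ S ∧ (a ∩ b).Nonempty) f f₁
  have step : ∀ v, ∀ f₁ ∈ S, ∀ e ∈ f₁, ∀ e' ∈ f₁, v ∈ e → v ∈ e' → P e → P e' :=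
    fun v f₁ hf₁ e he e' he' _ _ hP f₂ hf₂ he₂ =>
      (hP f₁ hf₁ he).tail ⟨hf₁, hf₂, e', he', he₂⟩
  have hP : ∀ {k h : B4} (v : Vertex), v ∈ edge k → v ∈ edge h → (P (edge k) ↔ P (edge h)) :=
    fun v hk hh =>
      ⟨link_propagate (hc v) (step v) (edge_mem_edges _) hk (edge_mem_edges _) hh,
        link_propagate (hc v) (step v) (edge_mem_edges _) hh (edge_mem_edges _) hk⟩
  -- The edges `k` and `kσ₁` share the vertex `kσ₁⟨δ⟩`, and `k` and `kδ` share `k⟨δ⟩`; since `σ 0`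
  -- and `δ` generate, all edges are reached.
  have inv := iff_of_invariant (P := fun k => P (edge k))
    (fun k => hP (vtx (k * σ 0)) (by simp [edge]) (by simp [edge]))
    (fun k => hP (vtx k) (by simp [edge, vtx_mul_δ]) (by simp [edge]))
  have hex : ∀ f ∈ S, ∃ k, edge k ∈ f := by
    intro f hf
    obtain ⟨k, rfl | rfl⟩ := mem_faces_iff.1 (hS hf) <;> exact ⟨k, Or.inl rfl⟩
  obtain ⟨k, hk⟩ := hex f hf
  obtain ⟨h, hh⟩ := hex f' hf'
  refine (inv k h).1 ?_ f' hf' hh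
  exact fun f₁ hf₁ hk₁ => .single ⟨hf, hf₁, _, hk, hk₁⟩

theorem link_reachable {v : Vertex} {f : Set (Sym2 Vertex)} (hf : f ∈ S)
    (x y : {e : Sym2 Vertex // e ∈ edges ∧ v ∈ e}) (hx : x.1 ∈ f) (hy : y.1 ∈ f) :
    (link S v).Reachable x y := by
  by_cases h : x = y
  · rw [h]
  · exact SimpleGraph.Adj.reachable ⟨h, f, hf, hx, hy⟩

theorem paritySurface_link_connected (g : B4) (v : Vertex) :
    (link (paritySurface g) v).Connected := by
  obtain ⟨w, rfl⟩ := QuotientGroup.mk_surjective v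
  change (link (paritySurface g) (vtx w)).Connected
  let out : ℤ → {e : Sym2 Vertex // e ∈ edges ∧ vtx w ∈ e} :=
    fun n => ⟨edge (w * δ ^ n), edge_mem_edges _, vtx_mem_edge_mul_zpow w n⟩
  let inn : ℤ → {e : Sym2 Vertex // e ∈ edges ∧ vtx w ∈ e} :=
    fun n => ⟨edge (w * δ ^ n * (σ 0)⁻¹), edge_mem_edges _, vtx_mem_edge_mul_zpow_inv w n⟩
  let R := (link (paritySurface g) (vtx w)).Reachable
  let Good : ℤ → Prop := fun n => Even (len w + 3 * n - len g)
  have tri : ∀ n, R (out (n + 1)) (inn n) := fun n =>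
    link_reachable (triangle_mem_paritySurface g (w * δ ^ n * (σ 0)⁻¹)) _ _
      (Or.inr (Or.inl (by rw [inv_mul_u_eq]))) (Or.inl rfl)
  have loz : ∀ n, Good n → R (out n) (out (n + 2)) := fun n hn =>
    link_reachable ((lozenge_mem_paritySurface (k := w * δ ^ n)).2
      (by rw [len_mul, len_zpow, len_δ]; convert hn using 1; ring)) _ _
      (Or.inl rfl) (Or.inr (Or.inl (by rw [mul_sq_eq])))
  have loz' : ∀ n, Good n → R (inn n) (inn (n + 2)) := fun n hn =>
    link_reachable ((lozenge_mem_paritySurface (k := w * δ ^ n * (σ 0)⁻¹ * q⁻¹)).2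
      (by
        simp only [Good, Int.even_iff, len_mul, len_zpow, len_δ, len_inv, len_q, len_σ] at hn ⊢
        omega)) _ _
      (Or.inr (Or.inr (Or.inl (by rw [inv_mul_cancel_right]))))
      (Or.inr (Or.inr (Or.inr (by rw [inv_mul_conj_eq]; rfl))))
  have acute : ∀ n, Good n → R (inn (n + 1)) (out (n + 3)) := fun n hn =>
    link_reachable ((lozenge_mem_paritySurface (k := w * δ ^ (n + 1) * (σ 0)⁻¹)).2
      (by
        simp only [Good, Int.even_iff, len_mul, len_zpow, len_δ, len_inv, len_σ] at hn ⊢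
        omega)) _ _
      (Or.inl rfl)
      (Or.inr (Or.inr (Or.inl (by rw [inv_mul_q_eq, add_assoc]; rfl))))
  -- The path runs out `n`, out `n + 2`, in `n + 1`, out `n + 3`, in `n + 2`, in `n`, out `n + 1`,
  -- alternating lozenge and triangle corners.
  have good_step : ∀ n, Good n → R (out n) (out (n + 1)) := by
    intro n hn
    have t1 := tri (n + 1)
    have t2 := tri (n + 2)
    rw [add_assoc] at t1 t2
    exact (loz n hn).trans (t1.trans ((acute n hn).trans (t2.trans ((loz' n hn).symm.trans
      (tri n).symm))))
  have step : ∀ n, R (out n) (out (n + 1)) := by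
    intro n
    by_cases hn : Good n
    · exact good_step n hn
    -- For the wrong parity, go back to out `n - 1`, which is joined to out `n` by the previous case
    -- and to out `n + 1` by an obtuse corner.
    · have hn' : Good (n - 1) := by
        simp only [Good, Int.even_iff] at hn ⊢; omega
      have h1 := good_step _ hn'
      have h2 := loz _ hn'
      rw [sub_add_cancel] at h1
      rw [show n - 1 + 2 = n + 1 by ring] at h2
      exact h1.symm.trans h2
  have hout : ∀ n, R (out n) (out 0) := by
    intro n
    induction n using Int.induction_on with
    | zero => rfl
    | succ n ih => exact (step n).symm.trans ih
    | pred n ih =>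
      have := step (-n - 1)
      rw [sub_add_cancel] at this
      exact this.trans ih
  have hall : ∀ x, R x (out 0) := by
    rintro ⟨e, he, hv⟩
    obtain ⟨k, rfl⟩ := mem_edges_iff.1 he
    rcases vtx_eq_or_of_mem_edge.1 hv with e | e
    · obtain ⟨n, rfl⟩ := vtx_eq_iff.1 e
      exact hout n
    · obtain ⟨n, hn⟩ := vtx_eq_iff.1 e
      obtain rfl : k = w * δ ^ n * (σ 0)⁻¹ := by rw [← hn, mul_inv_cancel_right]
      exact (tri n).symm.trans (hout _)
  have : Nonempty {e : Sym2 Vertex // e ∈ edges ∧ vtx w ∈ e} := ⟨out 0⟩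
  exact ⟨fun x y => (hall x).trans (hall y).symm⟩

theorem paritySurface_isHamiltonian (g : B4) : IsHamiltonianSurface (paritySurface g) where
  subset_faces := paritySurface_subset g
  nonempty := ⟨_, triangle_mem_paritySurface g g⟩
  two_faces _ he := paritySurface_two_faces g he
  connected _ hf _ hf' :=
    faces_connected (paritySurface_subset g) (paritySurface_link_connected g) hf hf'
  link_connected := paritySurface_link_connected g

end Brady

theorem theorem4p1 (f : Set (Sym2 Brady.Vertex)) (hf : Brady.IsLozenge f) :
    ∃! S : Set (Set (Sym2 Brady.Vertex)), Brady.IsHamiltonianSurface S ∧ f ∈ S := by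
  obtain ⟨g, rfl⟩ := Brady.isLozenge_iff.1 hf
  exact ⟨Brady.paritySurface g, ⟨Brady.paritySurface_isHamiltonian g,
    Brady.lozenge_mem_paritySurface.2 (by simp)⟩, fun S hS => Brady.eq_paritySurface hS.1 hS.2⟩
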